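/- For integers $b_1,\dots,b_m$ let $K_m(b_1,\dots,b_m)$ be the continuant, i.e. the determinant of the tridiagonal $m\times m$ matrix with diagonal entries $b_1,\dots,b_m$ and all entries directly above and below the diagonal equal to $1$ ($K_0=1$). For $n\ge 2$ put $$R_n(a_1,\dots,a_n)=K_n(a_1,\dots,a_n)-K_{n-2}(a_2,\dots,a_{n-1}).$$ Extend $(a_1,\dots,a_n)\in\mathbb Z^n$ to an $n$-periodic sequence $(a_i)_{i\in\mathbb Z}$. A solution of $R_n(a_1,\dots,a_n)=0$ is called totally positive if $K_{j-i+1}(a_i,\dots,a_j)>0$ for all $i\le j$ with $j-i\le n$ (for $n=2$: with $j-i\le 1$). For a triangulation of a convex $N$-gon with vertices labelled $1,\dots,N$ in cyclic order, its quiddity is the $N$-tuple whose $i$-th entry is the number of triangles adjacent to the $i$-th vertex. **Theorem.** Let $n\ge 2$. The totally positive integer solutions of $R_n(a_1,\dots,a_n)=0$ are in bijection with the centrally symmetric triangulations of a $2n$-gon. More precisely: 1. if $(a_1,\dots,a_n)\in\mathbb Z^n$ is a totally positive solution of $R_n=0$, then there is exactly one triangulation of the $2n$-gon with quiddity $(a_1,\dots,a_n,a_1,\dots,a_n)$,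 and this triangulation is centrally symmetric; 2. conversely, the quiddity of every centrally symmetric triangulation of the $2n$-gon is $(a_1,\dots,a_n,a_1,\dots,a_n)$ for exactly one totally positive integer solution $(a_1,\dots,a_n)$ of $R_n=0$. -/

import Mathlib

/-- The continuant `K_m(b₁, …, b_m)`: the determinant of the tridiagonal `m × m` matrix with
diagonal `b₁, …, b_m` and ones directly above and below the diagonal. -/
def continuant {m : ℕ} (b : Fin m → ℤ) : ℤ :=
  Matrix.det (Matrix.of fun i j : Fin m =>
    if i = j then b i
    else if (i : ℕ) + 1 = (j : ℕ) ∨ (j : ℕ) + 1 = (i : ℕ) then 1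
    else 0)

/-- The `m` consecutive entries, starting at position `i`, of the `n`-periodic extension of the
`n`-tuple `a` (positions are numbered from `0`). -/
def window {n : ℕ} (a : Fin n → ℤ) (i : Fin n) (m : ℕ) : Fin m → ℤ :=
  fun k => a ⟨((i : ℕ) + (k : ℕ)) % n, Nat.mod_lt _ i.pos⟩

/-- The rotundus `R_n(a₁, …, a_n) = K_n(a₁, …, a_n) - K_{n-2}(a₂, …, a_{n-1})`, with the usual
conventions `K₀ = 1`, `K₋₁ = 0`, `K₋₂ = -1`. -/
def rotundus : {n : ℕ} → (Fin n → ℤ) → ℤ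
  | 0, _ => 2
  | 1, a => a 0
  | _ + 2, a => continuant a - continuant fun k => a k.succ.castSucc

/-- Total positivity of an `n`-tuple `a`, extended `n`-periodically to `(a_i)`:
`K_{j-i+1}(a_i, …, a_j) > 0` whenever `0 ≤ j - i ≤ n`; here `m = j - i + 1`.
The bound `m ≤ 2 * n - 2` follows from `m ≤ n + 1` if `n ≥ 3`; for `n = 2` it removes the
condition `m = 3`, as `K₃(a₁, a₂, a₁) = K₃(a₂, a₁, a₂) = 0` whenever `a₁ a₂ = 2`. -/
def TotallyPositive {n : ℕ} (a : Fin n → ℤ) : Prop :=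
  ∀ (i : Fin n) (m : ℕ), 1 ≤ m → m ≤ n + 1 → m ≤ 2 * n - 2 → 0 < continuant (window a i m)

/-- A set of chords of a convex `N`-gon, whose vertices are labelled by `Fin N` in cyclic order,
given as a graph on the vertices: no two of the chords cross. Two chords of a convex polygon
cross in their interiors iff their endpoints alternate. -/
def IsNoncrossing {N : ℕ} (G : SimpleGraph (Fin N)) : Prop :=
  ∀ p q r s : Fin N, p < q → q < r → r < s → ¬ (G.Adj p r ∧ G.Adj q s)

/-- A triangulation of a convex `N`-gon (`N ≥ 3`), given as the graph formed by its sides and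
diagonals: it contains all sides of the polygon, no two of its diagonals cross, and no further
diagonal can be added. -/
structure IsTriangulation {N : ℕ} (G : SimpleGraph (Fin N)) : Prop where
  side : ∀ v : Fin N, G.Adj v (finRotate N v)
  noncrossing : IsNoncrossing G
  maximal : ∀ H : SimpleGraph (Fin N), IsNoncrossing H → G ≤ H → H = G

/-- The vertex opposite to `v` in a `2n`-gon, i.e. its image under the central symmetry. -/
def opposite {n : ℕ} (v : Fin (2 * n)) : Fin (2 * n) :=
  ⟨((v : ℕ) + n) % (2 * n), Nat.mod_lt _ v.pos⟩

def IsCentrallySymmetric {n : ℕ} (G : SimpleGraph (Fin (2 * n))) : Prop :=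
  ∀ u v : Fin (2 * n), G.Adj u v ↔ G.Adj (opposite u) (opposite v)

/-- The number of triangles of the triangulation `G` adjacent to each vertex. As the vertices
are in convex position, the triangles of `G` are exactly the triples of vertices that are
pairwise joined in `G`. -/
noncomputable def quiddity {N : ℕ} (G : SimpleGraph (Fin N)) : Fin N → ℤ :=
  fun v => (Set.ncard {t : Finset (Fin N) | G.IsNClique 3 t ∧ v ∈ t} : ℤ)

/-- The doubled tuple `(a₁, …, a_n, a₁, …, a_n)`. -/
def double {n : ℕ} (a : Fin n → ℤ) : Fin (2 * n) → ℤ :=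
  fun v => a ⟨(v : ℕ) % n, Nat.mod_lt _ (by have := v.pos; omega)⟩

/-! The continuants of the segments of a sequence `c` form a frieze `F`, the Wronskian of two
solutions of the Hill equation of `c`, and as such they satisfy Ptolemy's relation. The rotundus is
the trace of the monodromy of the Hill equation over one period, so by the Cayley-Hamilton relation
it vanishes iff the frieze changes sign when one of its arguments is shifted by two periods.

The friezes which are moreover positive are those of Conway and Coxeter. By Ptolemy's relation two
chords at which such a frieze has the value `1` do not cross, and every such chord other than a side
is the base of a triangle of such chords; so they form a triangulation. Conversely, in the frieze of
the quiddity of a triangulation all edges have the value `1`, and every other chord is reached from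
the edges by flips, each of which is governed by Ptolemy's relation; so the triangulation determines
its frieze, and the frieze is positive. Central symmetry of the triangulation of the `2 n`-gon is
the `n`-periodicity of its quiddity. -/

section Continuant

theorem det_eq_of_corner {R : Type*} [CommRing R] {m : ℕ}
    (A : Matrix (Fin (m + 2)) (Fin (m + 2)) R)
    (hrow : ∀ j : Fin m, A 0 j.succ.succ = 0) (hcol : ∀ i : Fin m, A i.succ.succ 0 = 0) :
    A.det = A 0 0 * (A.submatrix Fin.succ Fin.succ).det -
      A 0 1 * A 1 0 * (A.submatrix (Fin.succ ∘ Fin.succ) (Fin.succ ∘ Fin.succ)).det := by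
  have hminor : (A.submatrix Fin.succ (Fin.succAbove 1)).det =
      A 1 0 * (A.submatrix (Fin.succ ∘ Fin.succ) (Fin.succ ∘ Fin.succ)).det := by
    rw [Matrix.det_succ_column_zero, Fin.sum_univ_succ,
      Finset.sum_eq_zero fun i _ => by simp [hcol]]
    have hcomp : Fin.succAbove (1 : Fin (m + 2)) ∘ Fin.succ = Fin.succ ∘ Fin.succ := by
      ext j; simp [Fin.succAbove]
    simp only [Fin.val_zero, pow_zero, one_mul, add_zero, Matrix.submatrix_submatrix,
      Fin.succAbove_zero, hcomp]
    simp
  rw [Matrix.det_succ_row_zero, Fin.sum_univ_succ, Fin.sum_univ_succ,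
    Finset.sum_eq_zero fun j _ => by simp [hrow]]
  simp only [Fin.succ_zero_eq_one, hminor, Fin.succAbove_zero, Fin.val_zero, Fin.val_one]
  ring

theorem continuant_fin_zero (b : Fin 0 → ℤ) : continuant b = 1 :=
  Matrix.det_isEmpty

theorem continuant_fin_one (b : Fin 1 → ℤ) : continuant b = b 0 := by
  simp [continuant]

theorem continuant_succ_succ {m : ℕ} (b : Fin (m + 2) → ℤ) :
    continuant b = b 0 * continuant (fun k : Fin (m + 1) => b k.succ) -
      continuant (fun k : Fin m => b k.succ.succ) := by
  rw [continuant, det_eq_of_corner _ (by simp [Fin.ext_iff]) (by simp [Fin.ext_iff])]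
  simp only [continuant, Matrix.of_apply, if_true, zero_ne_one, one_ne_zero, if_false, Fin.val_zero,
    Fin.val_one, zero_add, true_or, or_true, one_mul]
  congr 3 <;> ext i j <;> simp

end Continuant

section Frieze

variable {R : Type*} [CommRing R]

/-- The solution of the discrete Hill equation `V (k + 2) = c (k + 1) * V (k + 1) - V k` with
`V 0 = x` and `V 1 = y`. -/
def hillSol (c : ℕ → R) (x y : R) : ℕ → R
  | 0 => x
  | 1 => y
  | k + 2 => c (k + 1) * hillSol c x y (k + 1) - hillSol c x y k

/-- The frieze of the sequence `c`: for `i < j` its entry at `(i, j)` is the continuant of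
`c (i + 1), …, c (j - 1)`. Defining it as a Wronskian of two solutions of the Hill equation makes it
antisymmetric in `i` and `j`, and turns Ptolemy's relation into a polynomial identity. -/
def frieze (c : ℕ → R) (i j : ℕ) : R :=
  hillSol c 1 0 i * hillSol c 0 1 j - hillSol c 0 1 i * hillSol c 1 0 j

variable (c : ℕ → R)

theorem frieze_self (i : ℕ) : frieze c i i = 0 := by
  unfold frieze; ring

theorem frieze_swap (i j : ℕ) : frieze c j i = -frieze c i j := by
  unfold frieze; ring

theorem frieze_ptolemy (i j k l : ℕ) :
    frieze c i k * frieze c j l =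
      frieze c i j * frieze c k l + frieze c i l * frieze c j k := by
  unfold frieze; ring

theorem frieze_add_two_right (i j : ℕ) :
    frieze c i (j + 2) = c (j + 1) * frieze c i (j + 1) - frieze c i j := by
  simp only [frieze, hillSol]; ring

theorem frieze_add_two_left (i j : ℕ) :
    frieze c (i + 2) j = c (i + 1) * frieze c (i + 1) j - frieze c i j := by
  simp only [frieze, hillSol]; ring

theorem frieze_succ (i : ℕ) : frieze c i (i + 1) = 1 := by
  induction i with
  | zero => simp [frieze, hillSol]
  | succ i ih => rw [frieze_add_two_right, frieze_self, frieze_swap, ih]; ring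

theorem frieze_add_two (i : ℕ) : frieze c i (i + 2) = c (i + 1) := by
  rw [frieze_add_two_right, frieze_succ, frieze_self]; ring

theorem frieze_expand (b i j : ℕ) :
    frieze c i j = frieze c i (b + 1) * frieze c b j - frieze c i b * frieze c (b + 1) j := by
  linear_combination -frieze_ptolemy c i b (b + 1) j - frieze c i j * frieze_succ c b

theorem frieze_comp_add (n i j : ℕ) :
    frieze (fun k => c (k + n)) i j = frieze c (i + n) (j + n) := by
  wlog hij : i ≤ j generalizing i j
  · rw [frieze_swap, frieze_swap c (j + n), this j i (Nat.le_of_not_le hij)]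
  obtain ⟨m, rfl⟩ := Nat.exists_eq_add_of_le hij
  clear hij
  induction m using Nat.twoStepInduction with
  | zero => simp only [add_zero, frieze_self]
  | one => rw [frieze_succ, add_right_comm, frieze_succ]
  | more m ih₀ ih₁ =>
    have hshift : i + (m + 2) + n = i + m + n + 2 := by ring
    have hshift' : i + (m + 1) + n = i + m + n + 1 := by ring
    rw [hshift, frieze_add_two_right, ← hshift', ← ih₀, ← ih₁, ← add_assoc, frieze_add_two_right]
    ring_nf

theorem continuant_eq_frieze (c : ℕ → ℤ) (m i : ℕ) :
    continuant (fun k : Fin m => c (i + 1 + k)) = frieze c i (i + m + 1) := by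
  induction m using Nat.twoStepInduction generalizing i with
  | zero => rw [continuant_fin_zero]; exact (frieze_succ c i).symm
  | one => rw [continuant_fin_one]; exact (frieze_add_two c i).symm
  | more m ih₀ ih₁ =>
    have htail₁ : continuant (fun k : Fin (m + 1) => c (i + 1 + k.succ)) =
        frieze c (i + 1) (i + (m + 2) + 1) := by
      rw [show i + (m + 2) + 1 = i + 1 + (m + 1) + 1 by ring, ← ih₁]
      congr! 3
      simp only [Fin.val_succ]
      ring
    have htail₂ : continuant (fun k : Fin m => c (i + 1 + k.succ.succ)) =
        frieze c (i + 2) (i + (m + 2) + 1) := by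
      rw [show i + (m + 2) + 1 = i + 2 + m + 1 by ring, ← ih₀]
      congr! 3
      simp only [Fin.val_succ]
      ring
    rw [continuant_succ_succ, htail₁, htail₂, frieze_add_two_left]
    simp

end Frieze

section Periodic

variable {R : Type*} [CommRing R] {c : ℕ → R} {n : ℕ}

theorem frieze_add_add_of_periodic (hc : Function.Periodic c n) (i j : ℕ) :
    frieze c (i + n) (j + n) = frieze c i j := by
  rw [← frieze_comp_add, funext hc]

theorem frieze_add_right_of_periodic (hc : Function.Periodic c n) (b i j : ℕ) :
    frieze c i (j + n) =
      frieze c i (b + 1 + n) * frieze c b j - frieze c i (b + n) * frieze c (b + 1) j := by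
  rw [frieze_expand c (b + n), add_right_comm b n 1, frieze_add_add_of_periodic hc,
    frieze_add_add_of_periodic hc]

/-- The Cayley-Hamilton relation `M ^ 2 = t M - 1` for the monodromy `M` of the Hill equation over
one period, whose trace `t` is computed from the base point `b`. -/
theorem frieze_add_two_mul_of_periodic (hc : Function.Periodic c n) (b i j : ℕ) :
    frieze c i (j + 2 * n) =
      (frieze c b (b + 1 + n) - frieze c (b + 1) (b + n)) * frieze c i (j + n) - frieze c i j := by
  have hone := frieze_succ c (b + n)
  rw [add_right_comm] at hone
  rw [two_mul, ← add_assoc, frieze_add_right_of_periodic hc b i (j + n)]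
  simp only [frieze_add_right_of_periodic hc b _ j]
  linear_combination frieze_expand c b i j
    - frieze c b j * frieze_ptolemy c i (b + 1) (b + n) (b + 1 + n)
    + frieze c (b + 1) j * frieze_ptolemy c i b (b + n) (b + 1 + n)
    + (frieze c i b * frieze c (b + 1) j - frieze c i (b + 1) * frieze c b j) * hone

theorem frieze_antiperiodic_iff (hc : Function.Periodic c n) (b : ℕ) :
    (∀ i j, frieze c i (j + 2 * n) = -frieze c i j) ↔
      frieze c b (b + 1 + n) - frieze c (b + 1) (b + n) = 0 := by
  refine ⟨fun h => ?_, fun htrace i j => ?_⟩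
  · have hCH := frieze_add_two_mul_of_periodic hc b n 1
    rw [h, add_comm 1 n, frieze_succ] at hCH
    linear_combination -hCH
  · rw [frieze_add_two_mul_of_periodic hc b, htrace, zero_mul, zero_sub]

theorem frieze_antiperiodic_of_closing {M : ℕ} (hc : Function.Periodic c (M + 1))
    (hside : frieze c 0 M = 1) (hzero : frieze c 0 (M + 1) = 0) (hfirst : frieze c 1 M = c 0)
    (i j : ℕ) : frieze c i (j + (M + 1)) = -frieze c i j := by
  have hlast : c (M + 1) = c 0 := by simpa using hc 0
  have h₀₁ : frieze c 0 (M + 2) = -1 := by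
    rw [frieze_add_two_right, hzero, hside]; ring
  have h₁₀ : frieze c 1 (M + 1) = 1 := by
    have hpt := frieze_ptolemy c 0 1 M (M + 1)
    rw [hside, frieze_succ c 0, frieze_succ, hzero] at hpt
    linear_combination hpt
  have h₁₁ : frieze c 1 (M + 2) = 0 := by
    rw [frieze_add_two_right, h₁₀, hfirst, hlast]; ring
  have hpt₀ := frieze_ptolemy c 0 1 i (M + 1)
  have hpt₁ := frieze_ptolemy c 0 1 i (M + 2)
  rw [frieze_succ c 0, hzero, h₁₀] at hpt₀
  rw [frieze_succ c 0, h₀₁, h₁₁] at hpt₁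
  rw [frieze_add_right_of_periodic hc 0, show 0 + 1 + (M + 1) = M + 2 by ring, zero_add]
  linear_combination frieze c 1 j * hpt₀ - frieze c 0 j * hpt₁ - frieze_ptolemy c 0 1 i j
    - frieze c i j * frieze_succ c 0

end Periodic

section Positive

theorem exists_between_frieze_eq_one {c : ℕ → ℤ} {i j : ℕ} (hij : i + 1 < j)
    (hone : frieze c i j = 1) (hpos : ∀ p q, i ≤ p → p < q → q ≤ j → 0 < frieze c p q) :
    ∃ k, i < k ∧ k < j ∧ frieze c i k = 1 ∧ frieze c k j = 1 := by
  -- The apex is the first `k` with `F k j ≤ F i k`: by Ptolemy's relation for `i, k - 1, k, j` the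
  -- opposite strict inequality at `k - 1` leaves room only for the value `1`.
  have hnonneg : ∀ p q, i ≤ p → p ≤ q → q ≤ j → 0 ≤ frieze c p q := fun p q hip hpq hqj =>
    hpq.eq_or_lt.elim (fun h => by rw [h, frieze_self]) fun h => (hpos p q hip h hqj).le
  have hj : i ≤ j ∧ frieze c j j ≤ frieze c i j := ⟨by omega, by rw [frieze_self, hone]; norm_num⟩
  have hex : ∃ k, i ≤ k ∧ frieze c k j ≤ frieze c i k := ⟨j, hj⟩
  obtain ⟨hik, hk⟩ := Nat.find_spec hex
  have hkj : Nat.find hex ≤ j := Nat.find_min' hex hj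
  have hmin : ∀ l < Nat.find hex, i ≤ l → frieze c i l < frieze c l j := fun l hl hil =>
    not_le.1 fun h => Nat.find_min hex hl ⟨hil, h⟩
  generalize Nat.find hex = k at hik hk hkj hmin
  have hne : i ≠ k := by rintro rfl; rw [frieze_self, hone] at hk; omega
  obtain ⟨l, rfl⟩ : ∃ l, k = l + 1 := ⟨k - 1, by omega⟩
  have hl := hmin l (by omega) (by omega)
  have hpt : frieze c i (l + 1) * frieze c l j = frieze c i l * frieze c (l + 1) j + 1 := by
    rw [frieze_ptolemy c i l (l + 1) j, frieze_succ, hone, mul_one]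
  have hil := hnonneg i l le_rfl (by omega) (by omega)
  have hlj := hnonneg (l + 1) j (by omega) hkj le_rfl
  have hone' : frieze c i (l + 1) = 1 := by
    have := hpos i (l + 1) le_rfl (by omega) hkj
    nlinarith
  rw [hone'] at hpt hk
  have hlt : l + 1 < j := by
    refine hkj.lt_of_ne fun h => ?_
    rw [h, frieze_self] at hpt
    rcases (show i ≤ l by omega).eq_or_lt with h' | h'
    · omega
    · have := hpos i l le_rfl h' (by omega)
      omega
  have := hpos (l + 1) j (by omega) hlt le_rfl
  exact ⟨l + 1, by omega, hlt, hone', by omega⟩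

end Positive

section Triangulation

variable {N : ℕ} {G : SimpleGraph (Fin N)}

theorem forall_adj_finRotate_iff : (∀ v, G.Adj v (finRotate N v)) ↔
    (∀ i j : Fin N, (i : ℕ) + 1 = j → G.Adj i j) ∧
      ∀ i j : Fin N, (i : ℕ) = 0 → (j : ℕ) + 1 = N → G.Adj i j := by
  rcases N with _ | M
  · simp
  refine ⟨fun h => ⟨fun i j hij => ?_, fun i j hi hj => ?_⟩, fun ⟨hsucc, hlast⟩ v => ?_⟩
  · have hrot : finRotate (M + 1) i = j := (finRotate_of_lt (by omega)).trans (Fin.ext hij)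
    exact hrot ▸ h i
  · obtain rfl : j = Fin.last M := Fin.ext (by simpa using hj)
    obtain rfl : i = 0 := Fin.ext hi
    exact (finRotate_last (n := M) ▸ h (Fin.last M)).symm
  · induction v using Fin.lastCases with
    | last => rw [finRotate_last]; exact (hlast _ _ rfl rfl).symm
    | cast v => exact hsucc _ _ (coe_finRotate_of_ne_last v.castSucc_lt_last.ne).symm

/-- Every edge `i j` of `G` other than the sides joining consecutive labels is the base of a
triangle whose apex lies between `i` and `j`. For noncrossing graphs containing the sides of the
polygon this characterizes triangulations, and it is the form in which they are used for
induction. -/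
def HasInnerTriangles (G : SimpleGraph (Fin N)) : Prop :=
  ∀ ⦃i j : Fin N⦄, (i : ℕ) + 1 < j → G.Adj i j → ∃ k, i < k ∧ k < j ∧ G.Adj i k ∧ G.Adj k j

theorem HasInnerTriangles.induction (hG : HasInnerTriangles G) {P : Fin N → Fin N → Prop}
    (side : ∀ i j : Fin N, (i : ℕ) + 1 = j → G.Adj i j → P i j)
    (triangle : ∀ i k j, i < k → k < j → G.Adj i k → G.Adj k j → G.Adj i j →
      P i k → P k j → P i j)
    {i j : Fin N} (hij : i < j) (hadj : G.Adj i j) : P i j := by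
  induction hd : (j : ℕ) - i using Nat.strong_induction_on generalizing i j with
  | _ d ih =>
    rw [Fin.lt_def] at hij
    rcases (Nat.succ_le_of_lt hij).eq_or_lt with hside | hlong
    · exact side i j hside hadj
    · obtain ⟨k, hik, hkj, hadj_ik, hadj_kj⟩ := hG hlong hadj
      exact triangle i k j hik hkj hadj_ik hadj_kj hadj
        (ih (k - i) (by omega) hik hadj_ik rfl) (ih (j - k) (by omega) hkj hadj_kj rfl)

theorem isTriangulation_of_hasInnerTriangles (hside : ∀ v, G.Adj v (finRotate N v))
    (hnc : IsNoncrossing G) (hinner : HasInnerTriangles G) : IsTriangulation G := by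
  refine ⟨hside, hnc, fun H hH hle => le_antisymm ?_ hle⟩
  have hsub : ∀ i j, i < j → G.Adj i j → ∀ p r, i ≤ p → p < r → r ≤ j → H.Adj p r → G.Adj p r := by
    intro i j hij hadj
    refine hinner.induction (P := fun i j => ∀ p r, i ≤ p → p < r → r ≤ j → H.Adj p r → G.Adj p r)
      (fun i j hij hadj p r hip hpr hrj _ => ?_) ?_ hij hadj
    · obtain rfl : p = i := by omega
      obtain rfl : r = j := by omega
      exact hadj
    · intro i k j _ _ hik hkj hadj ihleft ihright p r hip hpr hrj hH_pr
      rcases le_or_gt r k with hrk | hkr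
      · exact ihleft p r hip hpr hrk hH_pr
      rcases le_or_gt k p with hkp | hpk
      · exact ihright p r hkp hpr hrj hH_pr
      rcases hip.eq_or_lt with rfl | hip
      · rcases hrj.eq_or_lt with rfl | hrj
        · exact hadj
        · exact (hH i k r j hpk hkr hrj ⟨hH_pr, hle hkj⟩).elim
      · exact (hH i p k r hip hpk hkr ⟨hle hik, hH_pr⟩).elim
  obtain ⟨-, hlast⟩ := forall_adj_finRotate_iff.1 hside
  intro u v huv
  wlog h : u < v generalizing u v
  · exact (this huv.symm (huv.ne.symm.lt_of_le (not_lt.1 h))).symm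
  exact hsub ⟨0, by omega⟩ ⟨N - 1, by omega⟩ (Fin.lt_def.2 (by simp only; omega))
    (hlast _ _ rfl (by simp only; omega)) u v (Fin.le_def.2 (by simp)) h
    (Fin.le_def.2 (by simp only; omega)) huv

theorem IsTriangulation.adj_of_forall_not_crossing (hG : IsTriangulation G) {k j : Fin N}
    (hkj : k < j) (h : ∀ x y, k < x → x < j → y < k ∨ j < y → ¬G.Adj x y) : G.Adj k j := by
  suffices hnc : IsNoncrossing (G ⊔ SimpleGraph.edge k j) by
    rw [← hG.maximal _ hnc le_sup_left]
    simp [SimpleGraph.edge_adj, hkj.ne]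
  have hedge : ∀ p r, p < r → (G ⊔ SimpleGraph.edge k j).Adj p r → G.Adj p r ∨ p = k ∧ r = j := by
    intro p r hpr hadj
    rw [SimpleGraph.sup_adj, SimpleGraph.edge_adj] at hadj
    exact hadj.imp_right fun h => h.1.elim (by tauto) fun h => absurd hkj (by grind)
  rintro p q r s hpq hqr hrs ⟨hpr, hqs⟩
  replace hpr := hedge p r (hpq.trans hqr) hpr
  replace hqs := hedge q s (hqr.trans hrs) hqs
  rcases hpr with hpr | ⟨rfl, rfl⟩ <;> rcases hqs with hqs | ⟨rfl, rfl⟩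
  · exact hG.noncrossing p q r s hpq hqr hrs ⟨hpr, hqs⟩
  · exact h r p hqr hrs (Or.inl hpq) hpr.symm
  · exact h q s hpq hqr (Or.inr hrs) hqs
  · exact lt_irrefl _ hpq

theorem IsTriangulation.hasInnerTriangles (hG : IsTriangulation G) : HasInnerTriangles G := by
  classical
  intro i j hij hadj
  obtain ⟨hsucc, -⟩ := forall_adj_finRotate_iff.1 hG.side
  have hne : (Finset.univ.filter fun k => i < k ∧ k < j ∧ G.Adj i k).Nonempty :=
    ⟨⟨i + 1, by omega⟩, Finset.mem_filter.2 ⟨Finset.mem_univ _,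
      Fin.lt_def.2 (Nat.lt_succ_self _), Fin.lt_def.2 hij, hsucc _ _ rfl⟩⟩
  obtain ⟨k, hk, hmax⟩ := Finset.exists_max_image _ id hne
  simp only [Finset.mem_filter, Finset.mem_univ, true_and, id] at hk hmax
  obtain ⟨hik, hkj, hadj_ik⟩ := hk
  refine ⟨k, hik, hkj, hadj_ik, hG.adj_of_forall_not_crossing hkj ?_⟩
  rintro x y hkx hxj (hy | hy) hxy
  · rcases lt_trichotomy y i with hyi | rfl | hiy
    · exact hG.noncrossing y i x j hyi (hik.trans hkx) hxj ⟨hxy.symm, hadj⟩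
    · exact (hmax x ⟨hik.trans hkx, hxj, hxy.symm⟩).not_gt hkx
    · exact hG.noncrossing i y k x hiy hy hkx ⟨hadj_ik, hxy.symm⟩
  · exact hG.noncrossing i x j y (hik.trans hkx) hxj hy ⟨hadj, hxy⟩

/-- Any chord is reached from the edges of a triangulation by flips, i.e. by replacing one diagonal
of a quadrilateral by the other one. -/
theorem IsTriangulation.flip_induction (hG : IsTriangulation G) {Q : Fin N → Fin N → Prop}
    (edge : ∀ i j, i < j → G.Adj i j → Q i j)
    (flip_left : ∀ p q r s, p < q → q < r → r < s →
      Q p q → Q q r → Q r s → Q p s → Q q s → Q p r)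
    (flip_right : ∀ p q r s, p < q → q < r → r < s →
      Q p q → Q q r → Q r s → Q p s → Q p r → Q q s)
    {p r : Fin N} (hpr : p < r) : Q p r := by
  have key : ∀ i j, i < j → G.Adj i j → ∀ p r, i ≤ p → p < r → r ≤ j → Q p r := by
    intro i j hij hadj
    refine hG.hasInnerTriangles.induction (P := fun i j => ∀ p r, i ≤ p → p < r → r ≤ j → Q p r)
      (fun i j hij hadj p r hip hpr hrj => ?_) ?_ hij hadj
    · obtain rfl : p = i := by omega
      obtain rfl : r = j := by omega
      exact edge p r hpr hadj
    · intro i k j hik hkj hadj_ik hadj_kj hadj ihleft ihright p r hip hpr hrj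
      rcases le_or_gt r k with hrk | hkr
      · exact ihleft p r hip hpr hrk
      rcases le_or_gt k p with hkp | hpk
      · exact ihright p r hkp hpr hrj
      have hij := edge i j (hik.trans hkj) hadj
      have hQ_ir : Q i r := by
        rcases hrj.eq_or_lt with rfl | hrj
        · exact hij
        · exact flip_left i k r j hik hkr hrj (edge i k hik hadj_ik)
            (ihright k r le_rfl hkr hrj.le) (ihright r j hkr.le hrj le_rfl) hij
            (edge k j hkj hadj_kj)
      rcases hip.eq_or_lt with rfl | hip
      · exact hQ_ir
      · exact flip_right i p k r hip hpk hkr (ihleft i p le_rfl hip hpk.le)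
          (ihleft p k hip.le hpk le_rfl) (ihright k r le_rfl hkr hrj) hQ_ir
          (edge i k hik hadj_ik)
  obtain ⟨-, hlast⟩ := forall_adj_finRotate_iff.1 hG.side
  exact key ⟨0, by omega⟩ ⟨N - 1, by omega⟩ (Fin.lt_def.2 (by simp only; omega))
    (hlast _ _ rfl (by simp only; omega)) p r (Fin.le_def.2 (by simp)) hpr
    (Fin.le_def.2 (by simp only; omega))

end Triangulation

section Triangles

theorem not_isNClique_three_of_subset_pair {V : Type*} [DecidableEq V] {G : SimpleGraph V}
    {t : Finset V} {u v : V} (ht : t ⊆ {u, v}) : ¬G.IsNClique 3 t := fun hclique => by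
  have := (Finset.card_le_card ht).trans Finset.card_le_two
  rw [hclique.card_eq] at this
  omega

variable {N : ℕ} {G : SimpleGraph (Fin N)} {i j k v : Fin N}

/-- The triangles of `G` at the vertex `v` all of whose vertices lie between `i` and `j`. -/
def trianglesOn (G : SimpleGraph (Fin N)) (i j v : Fin N) : Set (Finset (Fin N)) :=
  {t | G.IsNClique 3 t ∧ v ∈ t ∧ (t : Set (Fin N)) ⊆ Set.Icc i j}

/-- The number of triangles at the vertex `v` in the part of the polygon with vertices `i, …, j`. -/
noncomputable def quiddityOn (G : SimpleGraph (Fin N)) (i j v : Fin N) : ℤ :=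
  (trianglesOn G i j v).ncard

theorem quiddityOn_zero_last {M : ℕ} (G : SimpleGraph (Fin (M + 1))) (v : Fin (M + 1)) :
    quiddityOn G 0 (Fin.last M) v = quiddity G v := by
  simp [quiddityOn, trianglesOn, quiddity, Set.subset_def, Fin.le_last]

theorem quiddityOn_of_notMem (hv : v ∉ Set.Icc i j) : quiddityOn G i j v = 0 := by
  have hempty : trianglesOn G i j v = ∅ :=
    Set.eq_empty_of_forall_notMem fun t ht => hv (ht.2.2 ht.2.1)
  rw [quiddityOn, hempty, Set.ncard_empty, Nat.cast_zero]

theorem quiddityOn_of_val_succ (hij : (i : ℕ) + 1 = j) : quiddityOn G i j v = 0 := by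
  have hempty : trianglesOn G i j v = ∅ := by
    refine Set.eq_empty_of_forall_notMem fun t ht => ?_
    refine not_isNClique_three_of_subset_pair (u := i) (v := j) (fun x hx => ?_) ht.1
    have := ht.2.2 hx
    rw [Set.mem_Icc, Fin.le_def, Fin.le_def] at this
    simp only [Finset.mem_insert, Finset.mem_singleton, Fin.ext_iff]
    omega
  rw [quiddityOn, hempty, Set.ncard_empty, Nat.cast_zero]

theorem IsNoncrossing.mem_Icc_of_adj (hG : IsNoncrossing G) (hadj : G.Adj i j) {u : Fin N}
    (hu : u ∈ Set.Ioo i j) (huv : G.Adj u v) : v ∈ Set.Icc i j := by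
  by_contra hv
  rw [Set.mem_Icc, not_and_or, not_le, not_le] at hv
  rcases hv with hv | hv
  · exact hG v i u j hv hu.1 hu.2 ⟨huv.symm, hadj⟩
  · exact hG i u j v hu.1 hu.2 hv ⟨hadj, huv⟩

theorem IsNoncrossing.quiddityOn_eq_quiddity (hG : IsNoncrossing G) (hadj : G.Adj i j)
    (hv : v ∈ Set.Ioo i j) : quiddityOn G i j v = quiddity G v := by
  have htriangles : trianglesOn G i j v = {t | G.IsNClique 3 t ∧ v ∈ t} := by
    refine Set.Subset.antisymm (fun t ht => ⟨ht.1, ht.2.1⟩) fun t ht => ⟨ht.1, ht.2, fun x hx => ?_⟩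
    rcases eq_or_ne v x with rfl | hne
    · exact Set.Ioo_subset_Icc_self hv
    · exact hG.mem_Icc_of_adj hadj hv (ht.1.isClique ht.2 hx hne)
  rw [quiddityOn, htriangles, quiddity]

theorem IsNoncrossing.subset_Icc_or_eq_triple (hG : IsNoncrossing G) (hik : G.Adj i k)
    (hkj : G.Adj k j) {t : Finset (Fin N)} (ht : G.IsNClique 3 t)
    (hsub : (t : Set (Fin N)) ⊆ Set.Icc i j) :
    (t : Set (Fin N)) ⊆ Set.Icc i k ∨ (t : Set (Fin N)) ⊆ Set.Icc k j ∨ t = {i, k, j} := by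
  by_contra! ⟨hleft, hright, htriple⟩
  obtain ⟨y, hyt, hy⟩ := Set.not_subset.1 hleft
  obtain ⟨x, hxt, hx⟩ := Set.not_subset.1 hright
  have hky : k < y := not_le.1 fun h => hy ⟨(hsub hyt).1, h⟩
  have hxk : x < k := not_le.1 fun h => hx ⟨h, (hsub hxt).2⟩
  have hends : ∀ x ∈ t, ∀ y ∈ t, x < k → k < y → x = i ∧ y = j := by
    refine fun x hxt y hyt hxk hky => ?_
    have hadj : G.Adj x y := ht.isClique hxt hyt (hxk.trans hky).ne
    refine ⟨by_contra fun hne => ?_, by_contra fun hne => ?_⟩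
    · exact hG i x k y ((hsub hxt).1.lt_of_ne' hne) hxk hky ⟨hik, hadj⟩
    · exact hG x k y j hxk hky ((hsub hyt).2.lt_of_ne hne) ⟨hadj, hkj⟩
  refine htriple (Finset.eq_of_subset_of_card_le (fun z hz => ?_) ?_)
  · rw [Finset.mem_insert, Finset.mem_insert, Finset.mem_singleton]
    rcases lt_trichotomy z k with h | h | h
    · exact Or.inl (hends z hz y hyt h hky).1
    · exact Or.inr (Or.inl h)
    · exact Or.inr (Or.inr (hends x hxt z hz hxk h).2)
  · exact ht.card_eq ▸ Finset.card_le_three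

theorem IsNoncrossing.trianglesOn_eq_union (hG : IsNoncrossing G) (hik : i < k) (hkj : k < j)
    (hadj_ik : G.Adj i k) (hadj_kj : G.Adj k j) (hadj_ij : G.Adj i j) (v : Fin N) :
    trianglesOn G i j v = trianglesOn G i k v ∪ trianglesOn G k j v ∪
      {t | t = {i, k, j} ∧ v ∈ t} := by
  have hclique : G.IsNClique 3 {i, k, j} :=
    SimpleGraph.is3Clique_triple_iff.2 ⟨hadj_ik, hadj_ij, hadj_kj⟩
  ext t
  constructor
  · rintro ⟨ht, hv, hsub⟩
    rcases hG.subset_Icc_or_eq_triple hadj_ik hadj_kj ht hsub with h | h | h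
    · exact Or.inl (Or.inl ⟨ht, hv, h⟩)
    · exact Or.inl (Or.inr ⟨ht, hv, h⟩)
    · exact Or.inr ⟨h, hv⟩
  · rintro ((⟨ht, hv, hsub⟩ | ⟨ht, hv, hsub⟩) | ⟨rfl, hv⟩)
    · exact ⟨ht, hv, hsub.trans (Set.Icc_subset_Icc_right hkj.le)⟩
    · exact ⟨ht, hv, hsub.trans (Set.Icc_subset_Icc_left hik.le)⟩
    · exact ⟨hclique, hv, by simp [Set.insert_subset_iff, hik.le, hkj.le, (hik.trans hkj).le]⟩

theorem IsNoncrossing.quiddityOn_eq_add (hG : IsNoncrossing G) (hik : i < k) (hkj : k < j)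
    (hadj_ik : G.Adj i k) (hadj_kj : G.Adj k j) (hadj_ij : G.Adj i j) (v : Fin N) :
    quiddityOn G i j v = quiddityOn G i k v + quiddityOn G k j v +
      if v = i ∨ v = k ∨ v = j then 1 else 0 := by
  have hdisj : Disjoint (trianglesOn G i k v) (trianglesOn G k j v) := by
    refine Set.disjoint_left.2 fun t hleft hright => ?_
    refine not_isNClique_three_of_subset_pair (u := k) (v := k) (fun x hx => ?_) hleft.1
    simpa using le_antisymm (hleft.2.2 hx).2 (hright.2.2 hx).1
  have hdisj' : Disjoint (trianglesOn G i k v ∪ trianglesOn G k j v)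
      {t | t = {i, k, j} ∧ v ∈ t} := by
    refine Set.disjoint_left.2 fun t ht ⟨htriple, _⟩ => ?_
    subst htriple
    rcases ht with ht | ht
    · exact (ht.2.2 (by simp : j ∈ _)).2.not_gt hkj
    · exact (ht.2.2 (by simp : i ∈ _)).1.not_gt hik
  have hcard : ({t | t = {i, k, j} ∧ v ∈ t} : Set (Finset (Fin N))).ncard =
      if v = i ∨ v = k ∨ v = j then 1 else 0 := by
    split_ifs with hv
    · refine Set.ncard_eq_one.2 ⟨{i, k, j}, Set.ext fun t => ⟨And.left, fun ht => ⟨ht, ?_⟩⟩⟩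
      rw [Set.mem_singleton_iff] at ht
      simpa [ht] using hv
    · refine (Set.ncard_eq_zero).2 (Set.eq_empty_of_forall_notMem fun t ⟨htriple, hvt⟩ => hv ?_)
      simpa [htriple] using hvt
  rw [quiddityOn, hG.trianglesOn_eq_union hik hkj hadj_ik hadj_kj hadj_ij,
    Set.ncard_union_eq hdisj', Set.ncard_union_eq hdisj, hcard]
  push_cast
  rfl

theorem IsNoncrossing.quiddityOn_left (hG : IsNoncrossing G) (hik : i < k) (hkj : k < j)
    (hadj_ik : G.Adj i k) (hadj_kj : G.Adj k j) (hadj_ij : G.Adj i j) :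
    quiddityOn G i j i = quiddityOn G i k i + 1 := by
  rw [hG.quiddityOn_eq_add hik hkj hadj_ik hadj_kj hadj_ij,
    quiddityOn_of_notMem (i := k) fun h => h.1.not_gt hik]
  simp

theorem IsNoncrossing.quiddityOn_right (hG : IsNoncrossing G) (hik : i < k) (hkj : k < j)
    (hadj_ik : G.Adj i k) (hadj_kj : G.Adj k j) (hadj_ij : G.Adj i j) :
    quiddityOn G i j j = quiddityOn G k j j + 1 := by
  rw [hG.quiddityOn_eq_add hik hkj hadj_ik hadj_kj hadj_ij,
    quiddityOn_of_notMem (j := k) fun h => h.2.not_gt hkj]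
  simp

theorem IsNoncrossing.quiddity_apex (hG : IsNoncrossing G) (hik : i < k) (hkj : k < j)
    (hadj_ik : G.Adj i k) (hadj_kj : G.Adj k j) (hadj_ij : G.Adj i j) :
    quiddity G k = quiddityOn G i k k + quiddityOn G k j k + 1 := by
  rw [← hG.quiddityOn_eq_quiddity hadj_ij ⟨hik, hkj⟩,
    hG.quiddityOn_eq_add hik hkj hadj_ik hadj_kj hadj_ij]
  simp

end Triangles

section ConwayCoxeter

variable {N : ℕ} {G : SimpleGraph (Fin N)} {c : ℕ → ℤ}

theorem IsTriangulation.frieze_of_adj (hG : IsTriangulation G)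
    (hc : ∀ v : Fin N, c v = quiddity G v) {i j : Fin N} (hij : i < j) (hadj : G.Adj i j) :
    frieze c i j = 1 ∧ frieze c (i + 1) j = quiddityOn G i j i ∧
      frieze c i (j + 1) = c j - quiddityOn G i j j := by
  refine hG.hasInnerTriangles.induction (P := fun i j => frieze c i j = 1 ∧
    frieze c (i + 1) j = quiddityOn G i j i ∧ frieze c i (j + 1) = c j - quiddityOn G i j j)
    (fun i j hij _ => ?_) ?_ hij hadj
  · rw [quiddityOn_of_val_succ hij, quiddityOn_of_val_succ hij, ← hij, frieze_self, frieze_succ,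
      frieze_add_two]
    simp
  · rintro i k j hik hkj hadj_ik hadj_kj hadj_ij ⟨hF_ik, hleft_ik, hright_ik⟩
      ⟨hF_kj, hleft_kj, hright_kj⟩
    have hapex := hG.noncrossing.quiddity_apex hik hkj hadj_ik hadj_kj hadj_ij
    have hF_ij : frieze c i j = 1 := by
      have hpt := frieze_ptolemy c i k (k + 1) j
      rw [hF_ik, hF_kj, hleft_kj, hright_ik, frieze_succ, hc k, hapex] at hpt
      linear_combination -hpt
    refine ⟨hF_ij, ?_, ?_⟩
    · have hpt := frieze_ptolemy c i (i + 1) k j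
      rw [hF_ik, hF_kj, hF_ij, hleft_ik, frieze_succ] at hpt
      rw [hG.noncrossing.quiddityOn_left hik hkj hadj_ik hadj_kj hadj_ij]
      linear_combination hpt
    · have hpt := frieze_ptolemy c i k j (j + 1)
      rw [hF_ik, hF_kj, hF_ij, hright_kj, frieze_succ] at hpt
      rw [hG.noncrossing.quiddityOn_right hik hkj hadj_ik hadj_kj hadj_ij]
      linear_combination -hpt

theorem IsTriangulation.frieze_pos (hG : IsTriangulation G)
    (hedge : ∀ i j : Fin N, i < j → G.Adj i j → frieze c i j = 1) {i j : Fin N} (hij : i < j) :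
    0 < frieze c i j := by
  refine hG.flip_induction (Q := fun i j => 0 < frieze c i j)
    (fun i j hij hadj => by rw [hedge i j hij hadj]; exact one_pos)
    (fun p q r s _ _ _ _ _ _ _ hqs => ?_) (fun p q r s _ _ _ _ _ _ _ hpr => ?_) hij
  · exact pos_of_mul_pos_left (by rw [frieze_ptolemy]; positivity) hqs.le
  · exact pos_of_mul_pos_right (by rw [frieze_ptolemy]; positivity) hpr.le

theorem IsTriangulation.frieze_congr {c' : ℕ → ℤ} (hG : IsTriangulation G)
    (hedge : ∀ i j : Fin N, i < j → G.Adj i j → frieze c i j = frieze c' i j)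
    (hne : ∀ i j : Fin N, i < j → frieze c i j ≠ 0) {i j : Fin N} (hij : i < j) :
    frieze c i j = frieze c' i j := by
  refine hG.flip_induction (Q := fun i j => frieze c i j = frieze c' i j) hedge
    (fun p q r s _ hqr hrs eq_pq eq_qr eq_rs eq_ps eq_qs => ?_)
    (fun p q r s hpq hqr _ eq_pq eq_qr eq_rs eq_ps eq_pr => ?_) hij
  all_goals
    have hpt := frieze_ptolemy c p q r s
    rw [eq_pq, eq_qr, eq_rs, eq_ps, ← frieze_ptolemy] at hpt
  · exact mul_right_cancel₀ (hne q s (hqr.trans hrs)) (hpt.trans (by rw [eq_qs]))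
  · exact mul_left_cancel₀ (hne p r (hpq.trans hqr)) (hpt.trans (by rw [eq_pr]))

/-- The frieze of `c` is the frieze of a triangulated `N`-gon in the sense of Conway and Coxeter: it
is `N`-antiperiodic, and all its entries in the strip between two consecutive zero diagonals are
positive. -/
structure IsConwayCoxeter (c : ℕ → ℤ) (N : ℕ) : Prop where
  antiperiodic : ∀ i j, frieze c i (j + N) = -frieze c i j
  pos : ∀ i j, i < j → j < i + N → 0 < frieze c i j

theorem frieze_reflect (hanti : ∀ i j, frieze c i (j + N) = -frieze c i j) (i j : ℕ) :
    frieze c j (i + N) = frieze c i j := by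
  rw [hanti, frieze_swap, neg_neg]

theorem IsConwayCoxeter.of_pos_of_lt (hanti : ∀ i j, frieze c i (j + N) = -frieze c i j)
    (hpos : ∀ i j, i < j → j < N → 0 < frieze c i j) : IsConwayCoxeter c N := by
  refine ⟨hanti, fun i j => ?_⟩
  induction j using Nat.strong_induction_on generalizing i with
  | _ j ih =>
    intro hij hji
    rcases lt_or_ge j N with hj | hj
    · exact hpos i j hij hj
    · obtain ⟨l, rfl⟩ := Nat.exists_eq_add_of_le' hj
      rw [frieze_reflect hanti]
      exact ih i hij l (by omega) (by omega)

theorem IsConwayCoxeter.two_le (hF : IsConwayCoxeter c N) : 2 ≤ N := by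
  have hone := frieze_succ c 0
  by_contra! hN
  interval_cases N
  · have := hF.antiperiodic 0 1
    rw [hone] at this
    omega
  · have := hF.antiperiodic 0 0
    rw [frieze_self, hone] at this
    omega

/-- The graph on the vertices of the polygon whose edges are the entries `1` of the frieze of `c`.
The absolute value makes the condition symmetric. -/
def friezeGraph (c : ℕ → ℤ) (N : ℕ) : SimpleGraph (Fin N) where
  Adj u v := |frieze c u v| = 1
  symm := ⟨fun u v h => by rw [frieze_swap, abs_neg]; exact h⟩
  loopless := ⟨fun v h => by rw [frieze_self] at h; simp at h⟩

theorem IsConwayCoxeter.friezeGraph_adj_iff (hF : IsConwayCoxeter c N) {u v : Fin N} (huv : u < v) :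
    (friezeGraph c N).Adj u v ↔ frieze c u v = 1 := by
  change |frieze c u v| = 1 ↔ _
  rw [abs_of_pos (hF.pos u v huv (by omega))]

theorem IsConwayCoxeter.isNoncrossing_friezeGraph (hF : IsConwayCoxeter c N) :
    IsNoncrossing (friezeGraph c N) := by
  rintro p q r s hpq hqr hrs ⟨hpr, hqs⟩
  rw [hF.friezeGraph_adj_iff (hpq.trans hqr)] at hpr
  rw [hF.friezeGraph_adj_iff (hqr.trans hrs)] at hqs
  have hpt := frieze_ptolemy c p q r s
  have pos_sides := mul_pos (hF.pos p q hpq (by omega)) (hF.pos r s hrs (by omega))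
  have pos_sides' := mul_pos (hF.pos p s (by omega) (by omega)) (hF.pos q r hqr (by omega))
  rw [hpr, hqs] at hpt
  omega

theorem IsConwayCoxeter.isTriangulation_friezeGraph (hF : IsConwayCoxeter c N) :
    IsTriangulation (friezeGraph c N) := by
  refine isTriangulation_of_hasInnerTriangles
    (forall_adj_finRotate_iff.2 ⟨fun i j hij => ?_, fun i j hi hj => ?_⟩)
    hF.isNoncrossing_friezeGraph fun i j hij hadj => ?_
  · rw [hF.friezeGraph_adj_iff (by omega), ← hij, frieze_succ]
  · have := hF.two_le
    rw [hF.friezeGraph_adj_iff (by omega), ← frieze_reflect hF.antiperiodic,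
      show (i : ℕ) + N = j + 1 by omega, frieze_succ]
  · have hij' : i < j := by omega
    rw [hF.friezeGraph_adj_iff hij'] at hadj
    obtain ⟨k, hik, hkj, hF_ik, hF_kj⟩ := exists_between_frieze_eq_one hij hadj
      fun p q _ hpq _ => hF.pos p q hpq (by omega)
    exact ⟨⟨k, by omega⟩, hik, hkj, (hF.friezeGraph_adj_iff hik).2 hF_ik,
      (hF.friezeGraph_adj_iff hkj).2 hF_kj⟩

theorem IsTriangulation.eq_friezeGraph (hG : IsTriangulation G)
    (hc : ∀ v : Fin N, c v = quiddity G v) (hF : IsConwayCoxeter c N) : G = friezeGraph c N := by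
  refine (hG.maximal _ hF.isNoncrossing_friezeGraph fun u v huv => ?_).symm
  wlog h : u < v generalizing u v
  · exact (this v u huv.symm (huv.ne.symm.lt_of_le (not_lt.1 h))).symm
  exact (hF.friezeGraph_adj_iff h).2 (hG.frieze_of_adj hc h huv).1

theorem IsTriangulation.frieze_zero_last {M : ℕ} {G : SimpleGraph (Fin (M + 1))}
    (hG : IsTriangulation G) (hc : ∀ v : Fin (M + 1), c v = quiddity G v) :
    frieze c 0 M = 1 ∧ frieze c 1 M = c 0 ∧ frieze c 0 (M + 1) = 0 := by
  have hadj : G.Adj 0 (Fin.last M) := (forall_adj_finRotate_iff.1 hG.side).2 _ _ rfl rfl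
  obtain ⟨hside, hfirst, hlast⟩ := hG.frieze_of_adj hc (Fin.pos_of_ne_zero hadj.ne') hadj
  rw [quiddityOn_zero_last, ← hc] at hfirst hlast
  exact ⟨hside, hfirst, hlast.trans (sub_self _)⟩

theorem IsTriangulation.isConwayCoxeter [NeZero N] (hG : IsTriangulation G)
    (hc : ∀ v : Fin N, c v = quiddity G v) (hper : Function.Periodic c N) :
    IsConwayCoxeter c N := by
  refine .of_pos_of_lt ?_ fun i j hij hj => ?_
  · obtain ⟨M, rfl⟩ := Nat.exists_eq_add_one_of_ne_zero (NeZero.ne N)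
    obtain ⟨hside, hfirst, hzero⟩ := hG.frieze_zero_last hc
    exact frieze_antiperiodic_of_closing hper hside hzero hfirst
  · exact hG.frieze_pos (fun i j hij hadj => (hG.frieze_of_adj hc hij hadj).1)
      (i := ⟨i, by omega⟩) (j := ⟨j, hj⟩) hij

theorem IsConwayCoxeter.quiddity_friezeGraph (hF : IsConwayCoxeter c N)
    (hper : Function.Periodic c N) (v : Fin N) : quiddity (friezeGraph c N) v = c v := by
  obtain ⟨M, rfl⟩ := Nat.exists_eq_add_of_le' hF.two_le
  have hG := hF.isTriangulation_friezeGraph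
  obtain ⟨q, hq⟩ : ∃ q : ℕ → ℤ, ∀ v : Fin (M + 2), q v = quiddity (friezeGraph c (M + 2)) v :=
    ⟨fun k => quiddity (friezeGraph c (M + 2)) (Fin.ofNat _ k), fun v => by simp⟩
  have hagree : ∀ i j, i ≤ j → j < M + 2 → frieze c i j = frieze q i j := by
    intro i j hij hj
    rcases hij.eq_or_lt with rfl | hij
    · rw [frieze_self, frieze_self]
    · refine hG.frieze_congr (fun i j hij hadj => ?_)
        (fun i j hij => (hF.pos i j hij (by omega)).ne') (i := ⟨i, by omega⟩) (j := ⟨j, hj⟩) hij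
      rw [(hF.friezeGraph_adj_iff hij).1 hadj, (hG.frieze_of_adj hq hij hadj).1]
  obtain ⟨hside, hfirst, hzero⟩ := hG.frieze_zero_last hq
  rw [← hq]
  rcases v with ⟨_ | v, hv⟩
  · rw [← hfirst, ← hagree _ _ (by omega) (by omega), ← frieze_reflect hF.antiperiodic,
      show 1 + (M + 2) = M + 1 + 2 by ring, frieze_add_two]
    simpa using hper 0
  · rcases (Nat.lt_succ_iff.1 hv).eq_or_lt with hlast | hlt
    · obtain rfl : v = M := by omega
      have hzero' := hF.antiperiodic 0 0
      rw [frieze_self, zero_add, frieze_add_two_right, hagree _ _ (by omega) (by omega),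
        hagree _ _ (by omega) (by omega), hside] at hzero'
      rw [frieze_add_two_right, hside] at hzero
      linear_combination hzero - hzero'
    · rw [← frieze_add_two q, ← frieze_add_two c, hagree _ _ (by omega) (by omega)]

end ConwayCoxeter

section Tuple

variable {n : ℕ} [NeZero n] (a : Fin n → ℤ)

/-- The `n`-periodic extension of an `n`-tuple, with positions numbered from `0`. -/
def periodicExt (k : ℕ) : ℤ := a (Fin.ofNat n k)

theorem periodic_periodicExt : Function.Periodic (periodicExt a) n := fun k => by
  simp [periodicExt, Fin.ofNat]

theorem periodicExt_val (i : Fin n) : periodicExt a i = a i := by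
  simp [periodicExt]

theorem double_eq_periodicExt (v : Fin (2 * n)) : double a v = periodicExt a v := rfl

theorem continuant_window (p m : ℕ) :
    continuant (window a (Fin.ofNat n (p + 1)) m) = frieze (periodicExt a) p (p + m + 1) := by
  rw [← continuant_eq_frieze]
  congr! 2 with k
  simp [window, periodicExt, Fin.ofNat]

theorem rotundus_eq_frieze_sub {M : ℕ} (a : Fin (M + 2) → ℤ) :
    rotundus a = frieze (periodicExt a) (M + 1) (M + 1 + 1 + (M + 2)) -
      frieze (periodicExt a) (M + 1 + 1) (M + 1 + (M + 2)) := by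
  have hval : ∀ k : Fin (M + 2), periodicExt a (M + 2 + k) = a k := fun k => by
    rw [add_comm _ (k : ℕ), periodic_periodicExt, periodicExt_val]
  rw [show M + 1 + 1 + (M + 2) = M + 1 + (M + 2) + 1 by ring, ← continuant_eq_frieze,
    show M + 1 + (M + 2) = M + 1 + 1 + M + 1 by ring, ← continuant_eq_frieze]
  refine congr_arg₂ (· - ·) (congrArg continuant (funext fun k => (hval k).symm))
    (congrArg continuant (funext fun k => ?_))
  rw [← hval, Fin.val_castSucc, Fin.val_succ]
  ring_nf

theorem rotundus_eq_zero_iff (hn : 2 ≤ n) : rotundus a = 0 ↔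
    ∀ i j, frieze (periodicExt a) i (j + 2 * n) = -frieze (periodicExt a) i j := by
  obtain ⟨M, rfl⟩ := Nat.exists_eq_add_of_le' hn
  rw [frieze_antiperiodic_iff (periodic_periodicExt a) (M + 1), rotundus_eq_frieze_sub]

theorem totallyPositive_iff : TotallyPositive a ↔
    ∀ p m, m ≤ n + 1 → m ≤ 2 * n - 2 → 0 < frieze (periodicExt a) p (p + m + 1) := by
  refine ⟨fun ha p m hm hm' => ?_, fun h i m _ hm hm' => ?_⟩
  · rcases m.eq_zero_or_pos with rfl | hpos
    · rw [add_zero, frieze_succ]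
      exact one_pos
    · rw [← continuant_window]
      exact ha _ m hpos hm hm'
  · have hi : Fin.ofNat n (i + n - 1 + 1) = i := by
      rw [Nat.sub_add_cancel (by omega)]
      ext
      simp [Fin.ofNat, Nat.mod_eq_of_lt]
    rw [← hi, continuant_window]
    exact h _ m hm hm'

theorem isConwayCoxeter_periodicExt_iff (hn : 2 ≤ n) :
    IsConwayCoxeter (periodicExt a) (2 * n) ↔ rotundus a = 0 ∧ TotallyPositive a := by
  rw [rotundus_eq_zero_iff a hn, totallyPositive_iff]
  refine ⟨fun hF => ⟨hF.antiperiodic, fun p m _ _ => hF.pos _ _ (by omega) (by omega)⟩,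
    fun ⟨hanti, hpos⟩ => .of_pos_of_lt hanti fun i j hij hj => ?_⟩
  obtain ⟨m, rfl⟩ := Nat.exists_eq_add_of_lt hij
  rcases le_or_gt (m + 1) n with hm | hm
  · exact hpos i m (by omega) (by omega)
  · obtain ⟨l, hl⟩ := Nat.exists_eq_add_of_lt (show i + m + 1 < i + 2 * n by omega)
    rw [← frieze_reflect hanti, hl]
    exact hpos (i + m + 1) l (by omega) (by omega)

theorem double_injective : Function.Injective (double (n := n)) := fun a b hab => by
  ext i
  rw [← periodicExt_val a, ← periodicExt_val b]
  exact congrFun hab ⟨i, by omega⟩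

end Tuple

section CentralSymmetry

variable {n : ℕ}

theorem opposite_involutive : Function.Involutive (opposite (n := n)) := fun v => by
  ext
  simp only [opposite, Nat.mod_add_mod]
  rw [add_assoc, ← two_mul, Nat.add_mod_right, Nat.mod_eq_of_lt v.2]

theorem exists_eq_double {f : Fin (2 * n) → ℤ} (hf : ∀ v, f (opposite v) = f v) :
    ∃ a : Fin n → ℤ, f = double a := by
  refine ⟨fun i => f ⟨i, by omega⟩, funext fun v => ?_⟩
  rcases lt_or_ge (v : ℕ) n with hv | hv
  · exact congrArg f (Fin.ext (Nat.mod_eq_of_lt hv).symm)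
  · obtain ⟨w, hw⟩ := Nat.exists_eq_add_of_le' hv
    rw [← hf]
    refine congrArg f (Fin.ext ?_)
    simp only [opposite]
    rw [hw, add_assoc, ← two_mul, Nat.add_mod_right, Nat.add_mod_right, Nat.mod_eq_of_lt (by omega),
      Nat.mod_eq_of_lt (by omega)]

theorem quiddity_le_of_hom {N N' : ℕ} {G : SimpleGraph (Fin N)} {G' : SimpleGraph (Fin N')}
    (f : G →g G') (hf : Function.Injective f) (v : Fin N) : quiddity G v ≤ quiddity G' (f v) := by
  refine Nat.cast_le.2 (Set.ncard_le_ncard_of_injOn (Finset.map ⟨f, hf⟩) ?_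
    (Finset.map_injective _).injOn (Set.toFinite _))
  rintro t ⟨ht, hv⟩
  refine ⟨⟨?_, by rw [Finset.card_map, ht.card_eq]⟩, Finset.mem_map_of_mem _ hv⟩
  rw [Finset.coe_map]
  rintro _ ⟨x, hx, rfl⟩ _ ⟨y, hy, rfl⟩ hxy
  exact f.map_adj (ht.isClique hx hy fun h => hxy (congrArg f h))

theorem IsCentrallySymmetric.quiddity_opposite {G : SimpleGraph (Fin (2 * n))}
    (hG : IsCentrallySymmetric G) (v : Fin (2 * n)) : quiddity G (opposite v) = quiddity G v := by
  have hle := quiddity_le_of_hom (⟨opposite, (hG _ _).1⟩ : G →g G) opposite_involutive.injective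
  exact le_antisymm ((hle (opposite v)).trans_eq (congrArg _ (opposite_involutive v))) (hle v)

theorem isCentrallySymmetric_friezeGraph {c : ℕ → ℤ} (hper : Function.Periodic c n)
    (hanti : ∀ i j, frieze c i (j + 2 * n) = -frieze c i j) :
    IsCentrallySymmetric (friezeGraph c (2 * n)) := by
  have habs : ∀ i j, |frieze c i (j % (2 * n))| = |frieze c i j| := fun i =>
    Function.Periodic.map_mod_nat (f := fun j => |frieze c i j|) fun j => by
      simp only [hanti, abs_neg]
  refine fun u v => Eq.congr ?_ rfl
  simp only [opposite]
  rw [habs ((u + n) % (2 * n)), frieze_swap c (v + n), abs_neg, habs, frieze_swap c (u + n),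
    abs_neg, frieze_add_add_of_periodic hper]

end CentralSymmetry

theorem theorem2 (n : ℕ) (hn : 2 ≤ n) :
    (∀ a : Fin n → ℤ, rotundus a = 0 → TotallyPositive a →
      (∃! G : SimpleGraph (Fin (2 * n)), IsTriangulation G ∧ quiddity G = double a) ∧
      (∀ G : SimpleGraph (Fin (2 * n)), IsTriangulation G → quiddity G = double a →
        IsCentrallySymmetric G)) ∧
    (∀ G : SimpleGraph (Fin (2 * n)), IsTriangulation G → IsCentrallySymmetric G →
      ∃! a : Fin n → ℤ, rotundus a = 0 ∧ TotallyPositive a ∧ quiddity G = double a) := by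
  have : NeZero n := ⟨by omega⟩
  have hper : ∀ a : Fin n → ℤ, Function.Periodic (periodicExt a) (2 * n) := fun a =>
    (periodic_periodicExt a).nat_mul 2
  have hval : ∀ {a : Fin n → ℤ} {G}, quiddity G = double a → ∀ v : Fin (2 * n),
      periodicExt a v = quiddity G v := fun hq v => by rw [hq, double_eq_periodicExt]
  refine ⟨fun a hR hpos => ?_, fun G hG hsymm => ?_⟩
  · have hF := (isConwayCoxeter_periodicExt_iff a hn).2 ⟨hR, hpos⟩
    have huniq : ∀ G, IsTriangulation G → quiddity G = double a →
        G = friezeGraph (periodicExt a) (2 * n) := fun G hG hq => hG.eq_friezeGraph (hval hq) hF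
    refine ⟨⟨_, ⟨hF.isTriangulation_friezeGraph, funext (hF.quiddity_friezeGraph (hper a))⟩,
      fun G hG => huniq G hG.1 hG.2⟩, fun G hG hq => ?_⟩
    rw [huniq G hG hq]
    exact isCentrallySymmetric_friezeGraph (periodic_periodicExt a) hF.antiperiodic
  · obtain ⟨a, hq⟩ := exists_eq_double hsymm.quiddity_opposite
    have hF := hG.isConwayCoxeter (hval hq) (hper a)
    obtain ⟨hR, hpos⟩ := (isConwayCoxeter_periodicExt_iff a hn).1 hF
    exact ⟨a, ⟨hR, hpos, hq⟩, fun b hb => double_injective (hb.2.2.symm.trans hq)⟩
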